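/- Let $N\ge 3$ and let $A$ be a normal $N\times N$ complex matrix with eigenvalues $\lambda=(\lambda_1,\dots,\lambda_N)$, listed with multiplicity. Write $\lambda=x+iy$ with $x,y\in\mathbb R^N$, and assume that $x,y$ are linearly independent and that the eigenvalues do not all lie on one straight line in $\mathbb C$. Let $P_A$ be the numerical shadow of $A$, i.e. the Borel probability measure on $\mathbb C$ given by $P_A(S)=\mu\{u\in\mathbb C^N:\|u\|=1,\ (Au,u)\in S\}$, where $\mu$ is the uniform probability measure on the unit sphere of $\mathbb C^N$. Let $\Delta_N=\{r\in\mathbb R^N: r_k\ge 0,\ \sum_k r_k=1\}$. There exist real $N\times N$ matrices $W$ whose first two columns are $x,y$ and whose remaining columns form an orthonormal basis of $\{x,y\}^\perp$. For every such $W$, put $\sigma=W^{*}(\Delta_N)$, an $(N-1)$-dimensional simplex in $\mathbb R^N$, and let $$M_{N-2,\sigma}(a,b)=\mathrm{vol}_{N-3}\big(\sigma\cap\{v\in\mathbb R^N: v_1=a,\ v_2=b\}\big)$$ be the associated $2$-dimensional B-spline, where $\mathrm{vol}_{N-3}$ is the Euclidean $(N-3)$-dimensional volume (Hausdorff measure normalized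 to agree with Lebesgue measure; counting measure if $N=3$). Then $M_{N-2,\sigma}$ is Borel measurable and $P_A$ is absolutely continuous with respect to planar Lebesgue measure, with density $$f_A(a+ib)=c_\lambda\, M_{N-2,\sigma}(a,b),\qquad c_\lambda=\frac{(N-1)!}{\sqrt{\det G(\mathbf 1,x,y)}}>0,$$ where $\mathbf 1=(1,\dots,1)\in\mathbb R^N$ and $G(\mathbf 1,x,y)$ is the $3\times 3$ Gram matrix of $\mathbf 1,x,y$. -/

import Mathlib

open scoped MeasureTheory

noncomputable section

/-- The uniform probability measure on the unit sphere of `ℂ^N`: the normalized surface measure. -/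
def uniformSphere (N : ℕ) :
    MeasureTheory.Measure (Metric.sphere (0 : EuclideanSpace ℂ (Fin N)) 1) :=
  let ω := (MeasureTheory.Measure.addHaar :
    MeasureTheory.Measure (EuclideanSpace ℂ (Fin N))).toSphere
  (ω Set.univ)⁻¹ • ω

/-- The value `(M u, u) = u^* M u` of the numerical range of `M`. -/
def numericalValue {N : ℕ} (M : Matrix (Fin N) (Fin N) ℂ) (u : EuclideanSpace ℂ (Fin N)) : ℂ :=
  star u.ofLp ⬝ᵥ M.mulVec u.ofLp

/-- The numerical shadow of `M`: the law of `(M u, u)` for a uniformly distributed unit vector `u`,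
as a Borel measure on `ℂ`. -/
def numericalShadow {N : ℕ} (M : Matrix (Fin N) (Fin N) ℂ) : MeasureTheory.Measure ℂ :=
  (uniformSphere N).map (fun u : Metric.sphere (0 : EuclideanSpace ℂ (Fin N)) 1 => numericalValue M u)

/-- The vector of real parts of `lam ∈ ℂ^N`. -/
def reVec {N : ℕ} (lam : Fin N → ℂ) : EuclideanSpace ℝ (Fin N) :=
  WithLp.toLp 2 (fun i => (lam i).re)

/-- The vector of imaginary parts of `lam ∈ ℂ^N`. -/
def imVec {N : ℕ} (lam : Fin N → ℂ) : EuclideanSpace ℝ (Fin N) :=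
  WithLp.toLp 2 (fun i => (lam i).im)

/-- The all-ones vector of `ℝ^N`. -/
def onesVec (N : ℕ) : EuclideanSpace ℝ (Fin N) :=
  WithLp.toLp 2 (fun _ => 1)

/-- The `j`-th column of a real square matrix, as a vector of Euclidean space. -/
def colVec {N : ℕ} (W : Matrix (Fin N) (Fin N) ℝ) (j : Fin N) : EuclideanSpace ℝ (Fin N) :=
  WithLp.toLp 2 (fun i => W i j)

/-- `W` has `x`, `y` as its first two columns, and its remaining columns form an orthonormal basis
of the orthogonal complement of `{x, y}`. (Columns are indexed from `0`.) -/
structure IsAdaptedMatrix {N : ℕ} (W : Matrix (Fin N) (Fin N) ℝ)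
    (x y : EuclideanSpace ℝ (Fin N)) : Prop where
  first : ∀ j : Fin N, (j : ℕ) = 0 → colVec W j = x
  second : ∀ j : Fin N, (j : ℕ) = 1 → colVec W j = y
  orthonormal : Orthonormal ℝ (fun j : {j : Fin N // 2 ≤ (j : ℕ)} => colVec W j)
  span_eq : Submodule.span ℝ (Set.range fun j : {j : Fin N // 2 ≤ (j : ℕ)} => colVec W j) =
    (Submodule.span ℝ {x, y})ᗮ

/-- The image `W^* (Δ_N)` of the standard simplex of `ℝ^N` under the transpose of `W`. -/
def simplexImage {N : ℕ} (W : Matrix (Fin N) (Fin N) ℝ) : Set (EuclideanSpace ℝ (Fin N)) :=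
  (fun r : Fin N → ℝ => WithLp.toLp 2 (W.transpose.mulVec r)) '' stdSimplex ℝ (Fin N)

/-- The slice `σ ∩ {v : v_j = x_j (j = 1, …, s)}` of a set `σ ⊆ ℝ^(s+k)`. -/
def bSplineSlice (s k : ℕ) {n : ℕ} (h : s + k = n) (σ : Set (EuclideanSpace ℝ (Fin n)))
    (x : Fin s → ℝ) : Set (EuclideanSpace ℝ (Fin n)) :=
  σ ∩ {v | ∀ j : Fin s, v (Fin.cast h (Fin.castAdd k j)) = x j}

/-- The `s`-dimensional B-spline `M_{k,σ}` of order `k` from a simplex `σ ⊆ ℝ^(s+k)`: the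
`(m - s)`-dimensional Euclidean volume of the slice of `σ` over `x`, where `m` is the dimension of
(the affine span of) `σ`. The volume is the Hausdorff measure normalized so that it
agrees with Lebesgue measure; in dimension `0` it is counting measure. -/
def bSpline (s k : ℕ) {n : ℕ} (h : s + k = n) (σ : Set (EuclideanSpace ℝ (Fin n)))
    (x : Fin s → ℝ) : ENNReal :=
  μHE[Module.finrank ℝ (vectorSpan ℝ σ) - s] (bSplineSlice s k h σ x)

/-- The constant `(N-1)! / √(det Gram(1, Re lam, Im lam))`, which normalizes the volumes of the
slices to total mass one. -/
def shadowConst {N : ℕ} (lam : Fin N → ℂ) : ℝ :=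
  ((N - 1).factorial : ℝ) /
    Real.sqrt (Matrix.gram ℝ ![onesVec N, reVec lam, imVec lam]).det

end

section

open scoped Pointwise
open MeasureTheory Set

/-! In an orthonormal eigenbasis, `(Au, u) = ∑ λ_i |u_i|²`, so the shadow is the law of `∑ λ_i t_i`
with `t_i = |u_i|²`. Squared modulus carries area on `ℂ` to `π` times length on the half-line, hence
volume on `ℂ^N` to `π^N` times volume on the positive orthant. Measuring a piece of the sphere by
the cone over it thus turns the uniform law on the sphere into the uniform law on the simplex, and
`P_A(S) = N! · vol (meanCone λ S)` (`numericalShadow_apply`).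

That cone is sliced in the linear coordinates `(⟨1, t⟩, ⟨x, t⟩ + i⟨y, t⟩, ⟨u_k, t⟩)`, where the
`u_k` form an orthonormal basis of `{1, x, y}ᗮ`. Non-collinearity of the eigenvalues makes `1, x, y`
independent, and the Jacobian is `√det G(1, x, y)` (`map_sliceCoord_volume`). Integrating out the
height gives a factor `1/N`, and Fubini leaves the integral over `z ∈ S` of the volume of the fibre
of the simplex over `z` (`volume_meanCone`).

Each fibre is parallel to `{1, x, y}ᗮ`, where the transpose of `W` is isometric, so its volume is
that of the slice of `σ` (`IsAdaptedMatrix.euclideanHausdorffMeasure_bSplineSlice`). The constant is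
`N! · (1/N) / √det G = c_λ`. -/

/-! ### Diagonalisation of normal matrices. -/

lemma exists_perm_of_map_univ_val_eq {ι α : Type*} [Fintype ι] {f g : ι → α}
    (h : Finset.univ.val.map f = Finset.univ.val.map g) : ∃ e : Equiv.Perm ι, ∀ i, f (e i) = g i := by
  classical
  have key : ∀ c, Nonempty ({i // g i = c} ≃ {i // f i = c}) := by
    intro c
    refine ⟨Fintype.equivOfCardEq ?_⟩
    have := congrArg (Multiset.count c) h
    rw [Multiset.count_map, Multiset.count_map] at this
    rw [Fintype.card_subtype, Fintype.card_subtype, Finset.card_def, Finset.card_def,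
      Finset.filter_val, Finset.filter_val]
    simp only [eq_comm (a := c)] at this
    exact this.symm
  exact ⟨Equiv.ofFiberEquiv fun c => (key c).some, fun i => Equiv.ofFiberEquiv_map _ i⟩

/-- A normal matrix has an orthonormal basis of eigenvectors. -/
lemma IsStarNormal.exists_orthonormalBasis_eigenvectors {n : ℕ} {A : Matrix (Fin n) (Fin n) ℂ}
    (hA : IsStarNormal A) :
    ∃ (b : OrthonormalBasis (Fin n) ℂ (EuclideanSpace ℂ (Fin n))) (d : Fin n → ℂ),
      ∀ i, A.toEuclideanLin (b i) = d i • b i := by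
  classical
  have hcomm : A.conjTranspose * A = A * A.conjTranspose := hA.star_comm_self
  -- Up to scaling, `B` and `C` are the Hermitian and skew-Hermitian parts of `A`, the latter made
  -- Hermitian by the factor `i`. Normality makes them commute, so the space splits into joint
  -- eigenspaces.
  let B : Matrix (Fin n) (Fin n) ℂ := A + A.conjTranspose
  let C : Matrix (Fin n) (Fin n) ℂ := Complex.I • (A - A.conjTranspose)
  have hB : B.toEuclideanLin.IsSymmetric := by
    rw [Matrix.isSymmetric_toEuclideanLin_iff]
    simp [Matrix.IsHermitian, B, add_comm]
  have hC : C.toEuclideanLin.IsSymmetric := by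
    rw [Matrix.isSymmetric_toEuclideanLin_iff]
    simp [Matrix.IsHermitian, C, ← smul_neg]
  have hBC : Commute B.toEuclideanLin C.toEuclideanLin := by
    have : Commute B C := by
      refine Commute.smul_right ?_ _
      change (A + A.conjTranspose) * (A - A.conjTranspose)
        = (A - A.conjTranspose) * (A + A.conjTranspose)
      simp only [mul_add, mul_sub, add_mul, sub_mul, hcomm]
      abel
    exact this.map (Matrix.toLpLinAlgEquiv 2 : _ ≃ₐ[ℂ] _)
  have hint := LinearMap.IsSymmetric.directSum_isInternal_of_commute hB hC hBC
  have horth := LinearMap.IsSymmetric.orthogonalFamily_eigenspace_inf_eigenspace hB hC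
  -- The joint eigenspaces are indexed by all of `ℂ × ℂ`. Only finitely many are nonzero, and
  -- restricting to those allows an orthonormal basis indexed by `Fin n`.
  have hfin := WellFoundedGT.finite_ne_bot_of_iSupIndep hint.submodule_iSupIndep
  have : Fintype {i : ℂ × ℂ // Module.End.eigenspace B.toEuclideanLin i.2 ⊓
      Module.End.eigenspace C.toEuclideanLin i.1 ≠ ⊥} := hfin.fintype
  have hint' := DirectSum.isInternal_ne_bot_iff.mpr hint
  have horth' := horth.comp (Subtype.val_injective
    (p := fun i : ℂ × ℂ => Module.End.eigenspace B.toEuclideanLin i.2 ⊓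
      Module.End.eigenspace C.toEuclideanLin i.1 ≠ ⊥))
  have hn : Module.finrank ℂ (EuclideanSpace ℂ (Fin n)) = n := by simp
  refine ⟨hint'.subordinateOrthonormalBasis hn horth', fun i =>
    let j := (hint'.subordinateOrthonormalBasisIndex hn i horth').1
    -- Read off from `A = B/2 - (i/2) C`; `j.2` is the eigenvalue of `B` and `j.1` that of `C`.
    (1 / 2 : ℂ) * j.2 - (Complex.I / 2) * j.1, fun i => ?_⟩
  have hs := hint'.subordinateOrthonormalBasis_subordinate hn i horth'
  set j := (hint'.subordinateOrthonormalBasisIndex hn i horth').1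
  set v := hint'.subordinateOrthonormalBasis hn horth' i
  obtain ⟨h1, h2⟩ := Submodule.mem_inf.mp hs
  rw [Module.End.mem_eigenspace_iff] at h1 h2
  have hAe : A = (1 / 2 : ℂ) • B - (Complex.I / 2) • C := by
    ext a b
    simp only [B, C, Matrix.sub_apply, Matrix.smul_apply, Matrix.add_apply, smul_eq_mul]
    linear_combination (A a b - A.conjTranspose a b) / 2 * Complex.I_mul_I
  conv_lhs => rw [hAe]
  rw [map_sub, map_smul, map_smul, LinearMap.sub_apply, LinearMap.smul_apply,
    LinearMap.smul_apply, h1, h2, smul_smul, smul_smul, ← sub_smul]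

/-- The eigenvalues produced by diagonalisation and the prescribed list are the same multiset of
roots of the characteristic polynomial, so a permutation of the basis matches them. -/
lemma exists_orthonormalBasis_eigenvectors_of_roots {n : ℕ} {A : Matrix (Fin n) (Fin n) ℂ}
    (hA : IsStarNormal A) {d : Fin n → ℂ} (hd : A.charpoly.roots = Finset.univ.val.map d) :
    ∃ b : OrthonormalBasis (Fin n) ℂ (EuclideanSpace ℂ (Fin n)),
      ∀ i, A.toEuclideanLin (b i) = d i • b i := by
  obtain ⟨b, c, hb⟩ := hA.exists_orthonormalBasis_eigenvectors
  have hdiag : LinearMap.toMatrix b.toBasis b.toBasis A.toEuclideanLin = Matrix.diagonal c := by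
    ext i j
    rw [LinearMap.toMatrix_apply, OrthonormalBasis.coe_toBasis, hb j,
      OrthonormalBasis.coe_toBasis_repr_apply, map_smul, b.repr_self]
    by_cases hij : i = j <;> simp [hij]
  have hchar : A.charpoly = (Matrix.diagonal c).charpoly := by
    rw [← hdiag, LinearMap.charpoly_toMatrix,
      ← LinearMap.charpoly_toMatrix _ (EuclideanSpace.basisFun (Fin n) ℂ).toBasis]
    congr 1
    ext i j
    simp [LinearMap.toMatrix_apply, Matrix.toLpLin_apply]
  have hroots : (Finset.univ.val.map c) = Finset.univ.val.map d := by
    rw [← hd, hchar, Matrix.charpoly_diagonal, Polynomial.roots_prod _ _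
      (Finset.prod_ne_zero_iff.mpr fun i _ => Polynomial.X_sub_C_ne_zero _)]
    simp [Multiset.bind_singleton]
  obtain ⟨e, he⟩ := exists_perm_of_map_univ_val_eq hroots
  exact ⟨b.reindex e.symm, fun i => by simp [hb, he]⟩

/-- The value depends on `u` only through the squared moduli of its eigencoordinates, which is what
lets the problem descend to the simplex. -/
lemma numericalValue_eq_sum {n : ℕ} {A : Matrix (Fin n) (Fin n) ℂ} {d : Fin n → ℂ}
    (b : OrthonormalBasis (Fin n) ℂ (EuclideanSpace ℂ (Fin n)))
    (hb : ∀ i, A.toEuclideanLin (b i) = d i • b i) (u : EuclideanSpace ℂ (Fin n)) :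
    numericalValue A u = ∑ i, d i * ((‖b.repr u i‖ ^ 2 : ℝ) : ℂ) := by
  have h1 : numericalValue A u = inner ℂ u (A.toEuclideanLin u) := by
    rw [EuclideanSpace.inner_eq_star_dotProduct, numericalValue, Matrix.ofLp_toLpLin,
      Matrix.toLin'_apply, dotProduct_comm]
  have h2 : ∀ i, b.repr (A.toEuclideanLin u) i = d i * b.repr u i := by
    intro i
    have : A.toEuclideanLin u = ∑ j, (b.repr u j * d j) • b j := by
      conv_lhs => rw [← b.sum_repr u]
      simp [map_sum, hb, smul_smul]
    rw [this, map_sum]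
    simp only [map_smul, b.repr_self]
    simp [mul_comm, Pi.single_apply]
  rw [h1, ← b.repr.inner_map_map, PiLp.inner_apply]
  refine Finset.sum_congr rfl fun i _ => ?_
  rw [h2, ← Complex.normSq_eq_norm_sq, Complex.normSq_eq_conj_mul_self]
  simp only [RCLike.inner_apply]
  ring

/-! ### From the uniform sphere to the uniform simplex. -/

/-- The squared modulus pushes the area of `ℂ` forward to `π` times Lebesgue measure. -/
lemma Complex.map_norm_sq_volume :
    (volume : Measure ℂ).map (fun z => ‖z‖ ^ 2) = NNReal.pi • volume.restrict (Ici (0 : ℝ)) := by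
  symm
  refine Real.measure_ext_Ioo_rat fun p q => ?_
  have hm : Measurable (fun z : ℂ => ‖z‖ ^ 2) := by fun_prop
  rw [Measure.map_apply hm measurableSet_Ioo, Measure.smul_apply,
    Measure.restrict_apply measurableSet_Ioo, ENNReal.smul_def, smul_eq_mul]
  generalize (p : ℝ) = p
  generalize (q : ℝ) = q
  have hball : ∀ r : ℝ, 0 ≤ r → volume {z : ℂ | ‖z‖ ^ 2 < r} = NNReal.pi * ENNReal.ofReal r := by
    intro r hr
    have : {z : ℂ | ‖z‖ ^ 2 < r} = Metric.ball 0 (√r) := by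
      ext z
      simp [Real.lt_sqrt (norm_nonneg z)]
    rw [this, Complex.volume_ball, ← ENNReal.ofReal_pow (Real.sqrt_nonneg _), Real.sq_sqrt hr,
      mul_comm]
  -- The preimage of the interval is empty, a disc or an annulus, according to the signs of the
  -- endpoints.
  rcases le_or_gt q 0 with hq | hq
  · have h1 : Ioo p q ∩ Ici 0 = ∅ := by
      ext x; simp only [mem_inter_iff, mem_Ioo, mem_Ici, mem_empty_iff_false, iff_false]
      intro h; linarith [h.1.2, h.2]
    have h2 : (fun z : ℂ => ‖z‖ ^ 2) ⁻¹' Ioo p q = ∅ := by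
      ext x; simp only [mem_preimage, mem_Ioo, mem_empty_iff_false, iff_false]
      intro h; linarith [h.2, sq_nonneg ‖x‖]
    rw [h1, h2]; simp
  rcases lt_or_ge p 0 with hp | hp
  · have h1 : Ioo p q ∩ Ici 0 = Ico 0 q := by
      ext x; simp only [mem_inter_iff, mem_Ioo, mem_Ici, mem_Ico]
      constructor
      · intro h; exact ⟨h.2, h.1.2⟩
      · intro h; exact ⟨⟨by linarith [h.1], h.2⟩, h.1⟩
    have h2 : (fun z : ℂ => ‖z‖ ^ 2) ⁻¹' Ioo p q = {z : ℂ | ‖z‖ ^ 2 < q} := by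
      ext x; simp only [mem_preimage, mem_Ioo, mem_ofPred_eq, and_iff_right_iff_imp]
      intro _; linarith [sq_nonneg ‖x‖]
    rw [h1, h2, hball q hq.le, Real.volume_Ico, sub_zero]
  · have h1 : Ioo p q ∩ Ici 0 = Ioo p q := by
      ext x; simp only [mem_inter_iff, mem_Ioo, mem_Ici, and_iff_left_iff_imp]
      intro h; linarith [h.1]
    have h2 : (fun z : ℂ => ‖z‖ ^ 2) ⁻¹' Ioo p q
        = {z : ℂ | ‖z‖ ^ 2 < q} \ Metric.closedBall 0 (√p) := by
      ext x
      simp only [mem_preimage, mem_Ioo, mem_sdiff, mem_ofPred_eq, Metric.mem_closedBall,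
        dist_zero_right, not_le, Real.sqrt_lt hp (norm_nonneg x)]
      tauto
    rw [h1, h2, Real.volume_Ioo]
    rcases le_or_gt q p with hqp | hqp
    · rw [ENNReal.ofReal_of_nonpos (by linarith), mul_zero, eq_comm]
      refine measure_mono_null (t := ∅) ?_ measure_empty
      intro x hx
      simp only [mem_sdiff, mem_ofPred_eq, Metric.mem_closedBall, dist_zero_right, not_le,
        Real.sqrt_lt hp (norm_nonneg x)] at hx
      linarith [hx.1, hx.2]
    · rw [measure_sdiff _ Metric.isClosed_closedBall.measurableSet.nullMeasurableSet
        (by simp [Complex.volume_closedBall, ENNReal.mul_eq_top]), hball q hq.le,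
        Complex.volume_closedBall, ← ENNReal.ofReal_pow (Real.sqrt_nonneg _), Real.sq_sqrt hp,
        ENNReal.ofReal_sub _ hp, ENNReal.mul_sub (by simp), mul_comm (ENNReal.ofReal p)]
      intro x hx
      simp only [Metric.mem_closedBall, dist_zero_right, mem_ofPred_eq] at hx ⊢
      have := Real.le_sqrt (norm_nonneg x) hp |>.mp hx
      linarith

lemma MeasureTheory.Measure.pi_const_smul {ι α : Type*} [Fintype ι] [MeasurableSpace α]
    (c : NNReal) (m : Measure α) [SigmaFinite m] :
    Measure.pi (fun _ : ι => c • m) = (c ^ Fintype.card ι) • Measure.pi (fun _ : ι => m) := by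
  refine Measure.pi_eq fun s hs => ?_
  simp only [Measure.smul_apply, Measure.pi_pi, ENNReal.smul_def, smul_eq_mul,
    Finset.prod_mul_distrib, Finset.prod_const, Finset.card_univ, ENNReal.coe_pow]

lemma Complex.map_pi_norm_sq_volume {ι : Type*} [Fintype ι] :
    (volume : Measure (ι → ℂ)).map (fun w i => ‖w i‖ ^ 2) =
      (NNReal.pi ^ Fintype.card ι) • volume.restrict {t : ι → ℝ | ∀ i, 0 ≤ t i} := by
  have : SigmaFinite ((volume : Measure ℂ).map (fun z => ‖z‖ ^ 2)) := by
    rw [Complex.map_norm_sq_volume]; infer_instance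
  rw [volume_pi, Measure.pi_map_pi (f := fun _ z => ‖z‖ ^ 2)
    (fun i => (by fun_prop : Measurable (fun z : ℂ => ‖z‖ ^ 2)).aemeasurable)]
  simp only [Complex.map_norm_sq_volume]
  rw [Measure.pi_const_smul, ← Measure.restrict_pi_pi, volume_pi]
  congr 2
  ext t; simp [Pi.le_def]

/-- The cone over the part of the simplex on which the mean `∑ d i * t i` lies in `S`,
cut off at height one. -/
def meanCone {N : ℕ} (d : Fin N → ℂ) (S : Set ℂ) : Set (Fin N → ℝ) :=
  {t | (∀ i, 0 ≤ t i) ∧ 0 < ∑ i, t i ∧ ∑ i, t i < 1 ∧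
    (∑ i, d i * (t i : ℂ)) / ((∑ i, t i : ℝ) : ℂ) ∈ S}

lemma measurableSet_meanCone {N : ℕ} (d : Fin N → ℂ) {S : Set ℂ} (hS : MeasurableSet S) :
    MeasurableSet (meanCone d S) := by
  have h1 : MeasurableSet {t : Fin N → ℝ | ∀ i, 0 ≤ t i} := by
    have : {t : Fin N → ℝ | ∀ i, 0 ≤ t i} = Ici 0 := by ext; simp [Pi.le_def]
    rw [this]; exact isClosed_Ici.measurableSet
  refine h1.inter (MeasurableSet.inter ?_ (MeasurableSet.inter ?_ ?_))
  · exact measurableSet_lt measurable_const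
      (by fun_prop : Measurable fun t : Fin N → ℝ => ∑ i, t i)
  · exact measurableSet_lt (by fun_prop : Measurable fun t : Fin N → ℝ => ∑ i, t i)
      measurable_const
  · exact (by fun_prop : Measurable fun t : Fin N → ℝ =>
      (∑ i, d i * (t i : ℂ)) / ((∑ i, t i : ℝ) : ℂ)) hS

/-- Volume of the unit ball of `ℂ^N`, the source of the factor `N!` in the normalised sphere
measure. -/
lemma Complex.volume_sum_norm_sq_lt_one (ι : Type*) [Fintype ι] :
    volume {w : ι → ℂ | ∑ i, ‖w i‖ ^ 2 < 1} =
      NNReal.pi ^ Fintype.card ι / (Fintype.card ι).factorial := by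
  have h := Complex.volume_sum_rpow_lt_one ι (p := 2) (by norm_num)
  simp only [Real.rpow_two] at h
  rw [h]
  have h2 : (2 : ℝ) / 2 + 1 = (1 : ℕ) + 1 := by norm_num
  have h3 : 2 * (Fintype.card ι : ℝ) / 2 + 1 = (Fintype.card ι : ℝ) + 1 := by ring
  rw [h2, h3, Real.Gamma_nat_eq_factorial, Real.Gamma_nat_eq_factorial,
    ENNReal.ofReal_div_of_pos (by positivity), ENNReal.ofReal_natCast, ENNReal.ofReal_pow
    (by positivity)]
  rw [← NNReal.coe_real_pi, Nat.factorial_one, Nat.cast_one, mul_one, ENNReal.ofReal_coe_nnreal]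

/-- The numerical shadow of a matrix with an orthonormal eigenbasis, in terms of the uniform
distribution on the simplex. -/
lemma numericalShadow_apply {N : ℕ} (hN : 0 < N) {A : Matrix (Fin N) (Fin N) ℂ} {d : Fin N → ℂ}
    (b : OrthonormalBasis (Fin N) ℂ (EuclideanSpace ℂ (Fin N)))
    (hb : ∀ i, A.toEuclideanLin (b i) = d i • b i) {S : Set ℂ} (hS : MeasurableSet S) :
    numericalShadow A S = N.factorial * volume (meanCone d S) := by
  let L : EuclideanSpace ℂ (Fin N) ≃L[ℝ] (Fin N → ℂ) :=
    ((b.repr.toLinearEquiv.trans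
      (WithLp.linearEquiv 2 ℂ (Fin N → ℂ))).restrictScalars ℝ).toContinuousLinearEquiv
  have hLn : ∀ u, ∑ i, ‖L u i‖ ^ 2 = ‖u‖ ^ 2 := by
    intro u
    rw [← b.repr.norm_map u, EuclideanSpace.norm_sq_eq]
    rfl
  have hval : ∀ u, numericalValue A u = ∑ i, d i * ((‖L u i‖ ^ 2 : ℝ) : ℂ) :=
    fun u => numericalValue_eq_sum b hb u
  have hmeas : Measurable (fun u : Metric.sphere (0 : EuclideanSpace ℂ (Fin N)) 1 =>
      numericalValue A u) := by
    simp only [hval]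
    have : ∀ i, Continuous fun u : Metric.sphere (0 : EuclideanSpace ℂ (Fin N)) 1 => L u i :=
      fun i => (continuous_apply i).comp (L.continuous.comp continuous_subtype_val)
    refine Continuous.measurable ?_
    fun_prop
  set μ : Measure (EuclideanSpace ℂ (Fin N)) := Measure.addHaar with hμ
  -- By uniqueness of Haar measure; the value of `c` is irrelevant, since it cancels when the sphere
  -- measure is normalised.
  obtain ⟨c, hc⟩ : ∃ c : NNReal, μ.map L = c • (volume : Measure (Fin N → ℂ)) :=
    ⟨_, Measure.isAddLeftInvariant_eq_smul _ _⟩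
  have hLm : Measurable L := L.continuous.measurable
  have hpre : ∀ T : Set (Fin N → ℂ), MeasurableSet T → μ (L ⁻¹' T) = c * volume T := by
    intro T hT
    rw [← Measure.map_apply hLm hT, hc]; rfl
  have hball : μ (Metric.ball 0 1) = c * (NNReal.pi ^ N / N.factorial) := by
    have h0 : Metric.ball (0 : EuclideanSpace ℂ (Fin N)) 1
        = L ⁻¹' {w | ∑ i, ‖w i‖ ^ 2 < 1} := by
      ext u
      simp only [Metric.mem_ball, dist_zero_right, mem_preimage, mem_ofPred_eq, hLn]
      rw [sq_lt_one_iff₀ (norm_nonneg _)]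
    rw [h0, hpre _ (measurableSet_lt (by fun_prop) measurable_const),
      Complex.volume_sum_norm_sq_lt_one, Fintype.card_fin]
  -- `toSphere` measures a set by the real dimension times the volume of the open cone over it. Both
  -- `numericalValue` and `‖u‖²` are homogeneous of degree two, so this cone is the preimage of
  -- `meanCone d S` under squared moduli.
  have hcone : μ (Ioo (0 : ℝ) 1 • (Subtype.val '' ((fun u : Metric.sphere
      (0 : EuclideanSpace ℂ (Fin N)) 1 => numericalValue A u) ⁻¹' S)))
      = c * (NNReal.pi ^ N * volume (meanCone d S)) := by
    have h0 : (Ioo (0 : ℝ) 1 • (Subtype.val '' ((fun u : Metric.sphere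
      (0 : EuclideanSpace ℂ (Fin N)) 1 => numericalValue A u) ⁻¹' S)) : Set _)
        = L ⁻¹' ((fun w i => ‖w i‖ ^ 2) ⁻¹' meanCone d S) := by
      ext u
      simp only [mem_preimage, meanCone, mem_ofPred_eq, hLn, ← hval]
      constructor
      · rintro ⟨r, hr, _, ⟨v, hv, rfl⟩, rfl⟩
        have hv1 : ‖(v : EuclideanSpace ℂ (Fin N))‖ = 1 := by simp
        have hrv : ‖r • (v : EuclideanSpace ℂ (Fin N))‖ = r := by
          rw [norm_smul, hv1, mul_one, Real.norm_of_nonneg hr.1.le]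
        have hr0 : (r : ℂ) ≠ 0 := by exact_mod_cast hr.1.ne'
        refine ⟨fun i => by positivity, ?_, ?_, ?_⟩
        · simp only [hrv]; exact pow_pos hr.1 2
        · simp only [hrv]; exact (sq_lt_one_iff₀ hr.1.le).mpr hr.2
        · have h2 : numericalValue A (r • (v : EuclideanSpace ℂ (Fin N)))
              = (r : ℂ) ^ 2 * numericalValue A v := by
            rw [hval, hval, Finset.mul_sum]
            refine Finset.sum_congr rfl fun i _ => ?_
            rw [map_smul, Pi.smul_apply, norm_smul, Real.norm_of_nonneg hr.1.le]
            push_cast; ring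
          simp only [hrv, h2]
          push_cast
          rw [mul_div_cancel_left₀ _ (pow_ne_zero 2 hr0)]
          exact hv
      · rintro ⟨-, h1, h2, h3⟩
        have hu : 0 < ‖u‖ := by
          rcases (norm_nonneg u).lt_or_eq with h | h
          · exact h
          · rw [← h] at h1; norm_num at h1
        have hu0 : (‖u‖ : ℂ) ≠ 0 := by exact_mod_cast hu.ne'
        refine ⟨‖u‖, ⟨hu, (sq_lt_one_iff₀ hu.le).mp h2⟩, ‖u‖⁻¹ • u,
          ⟨⟨‖u‖⁻¹ • u, by simp [norm_smul, hu.ne']⟩, ?_, rfl⟩, ?_⟩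
        · have h4 : numericalValue A (‖u‖⁻¹ • u) = numericalValue A u / ((‖u‖ ^ 2 : ℝ) : ℂ) := by
            rw [hval, hval, Finset.sum_div]
            refine Finset.sum_congr rfl fun i _ => ?_
            rw [map_smul, Pi.smul_apply, norm_smul, norm_inv, norm_norm]
            push_cast; field_simp
          simp only [mem_preimage, h4]
          exact h3
        · simp [smul_smul, hu.ne']
    have hq : Measurable (fun (w : Fin N → ℂ) i => ‖w i‖ ^ 2) := by fun_prop
    have hmc := measurableSet_meanCone d hS
    rw [h0, hpre _ (hq hmc), ← Measure.map_apply hq hmc, Complex.map_pi_norm_sq_volume,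
      Measure.smul_apply, Measure.restrict_apply hmc,
      inter_eq_left.mpr (fun t ht => ht.1), Fintype.card_fin, ENNReal.smul_def, smul_eq_mul,
      ENNReal.coe_pow]
  have hc0 : (c : ENNReal) ≠ 0 := by
    intro h
    have := (Metric.measure_ball_pos μ (0 : EuclideanSpace ℂ (Fin N)) one_pos).ne'
    rw [hball, h, zero_mul] at this
    exact this rfl
  have hdim : (Module.finrank ℝ (EuclideanSpace ℂ (Fin N)) : ENNReal) ≠ 0 := by
    have : Nonempty (Fin N) := ⟨⟨0, hN⟩⟩
    exact_mod_cast (Module.finrank_pos (R := ℝ) (M := EuclideanSpace ℂ (Fin N))).ne'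
  rw [numericalShadow, Measure.map_apply hmeas hS, uniformSphere]
  simp only [Measure.smul_apply, smul_eq_mul]
  rw [← hμ, μ.toSphere_apply' (hmeas hS), μ.toSphere_apply_univ, hball, hcone]
  have hpi : ((NNReal.pi : ENNReal) ^ N) ≠ 0 := by
    exact pow_ne_zero _ (by exact_mod_cast NNReal.pi_ne_zero)
  have hpi' : ((NNReal.pi : ENNReal) ^ N) ≠ ⊤ := ENNReal.pow_ne_top ENNReal.coe_ne_top
  have hk : (N.factorial : ENNReal) ≠ 0 := by exact_mod_cast N.factorial_ne_zero
  generalize volume (meanCone d S) = V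
  generalize (NNReal.pi : ENNReal) ^ N = p at *
  have hdim' := ENNReal.natCast_ne_top (Module.finrank ℝ (EuclideanSpace ℂ (Fin N)))
  generalize (Module.finrank ℝ (EuclideanSpace ℂ (Fin N)) : ENNReal) = D at *
  -- The dimension `D`, the Haar constant `c` and `p = π^N` all cancel in the quotient of cone
  -- volume by ball volume; only `N!` survives.
  have hQ0 : D * c * p ≠ 0 := mul_ne_zero (mul_ne_zero hdim hc0) hpi
  have hQ : D * c * p ≠ ⊤ := ENNReal.mul_ne_top (ENNReal.mul_ne_top hdim' ENNReal.coe_ne_top) hpi'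
  have h1 : D * (c * (p / N.factorial)) = D * c * p / N.factorial := by
    simp only [div_eq_mul_inv]; ring
  have h2 : D * (c * (p * V)) = D * c * p * V := by ring
  rw [h1, h2, ENNReal.inv_div (Or.inl (by simp)) (Or.inl hk), div_eq_mul_inv, mul_assoc,
    ← mul_assoc _⁻¹, ENNReal.inv_mul_cancel hQ0 hQ, one_mul]

/-- The volume of a truncated cone of height one over a base of arbitrary dimension. -/
lemma MeasureTheory.Measure.prod_truncatedCone {F : Type*} [NormedAddCommGroup F]
    [NormedSpace ℝ F] [MeasurableSpace F] [BorelSpace F] [FiniteDimensional ℝ F] (μ : Measure F)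
    [μ.IsAddHaarMeasure] {D : Set (ℝ × F)} (hD : MeasurableSet D) {B : Set F}
    (hDB : ∀ s v, (s, v) ∈ D ↔ (0 < s ∧ s < 1) ∧ s⁻¹ • v ∈ B) :
    (volume.prod μ) D = ENNReal.ofReal (1 / (Module.finrank ℝ F + 1)) * μ B := by
  rw [Measure.prod_apply hD]
  -- The section at height `s` is the dilate `s • B`, of volume `s ^ dim F * μ B`; integrating over
  -- `0 < s < 1` gives `1 / (dim F + 1)`.
  have h : ∀ s : ℝ, μ (Prod.mk s ⁻¹' D) =
      (Ioo (0 : ℝ) 1).indicator (fun s => ENNReal.ofReal (s ^ Module.finrank ℝ F) * μ B) s := by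
    intro s
    by_cases hs : s ∈ Ioo (0 : ℝ) 1
    · rw [indicator_of_mem hs, ← Measure.addHaar_smul_of_nonneg μ hs.1.le]
      congr 1
      ext v
      rw [mem_preimage, hDB, mem_smul_set_iff_inv_smul_mem₀ hs.1.ne']
      exact and_iff_right hs
    · rw [indicator_of_notMem hs]
      refine measure_mono_null (t := ∅) ?_ measure_empty
      intro v hv
      exact hs ((hDB s v).mp hv).1
  simp_rw [h]
  rw [lintegral_indicator measurableSet_Ioo, lintegral_mul_const _ (by fun_prop)]
  congr 1
  rw [← ofReal_integral_eq_lintegral_ofReal, ← integral_Ioc_eq_integral_Ioo,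
    ← intervalIntegral.integral_of_le zero_le_one, integral_pow]
  · simp
  · exact (intervalIntegral.intervalIntegrable_pow _ |>.1).mono_set Ioo_subset_Ioc_self
  · filter_upwards [ae_restrict_mem measurableSet_Ioo] with s hs
    exact pow_nonneg hs.1.le _

/-! ### Linear coordinates adapted to mass and mean, and their Jacobian. -/

section Coordinates

variable {N m : ℕ}

/-- The coordinates `(⟪v 0, t⟫, ⟪v 1, t⟫ + i ⟪v 2, t⟫, (⟪u k, t⟫)ₖ)` on `ℝ^N`. -/
noncomputable def sliceCoord (v : Fin 3 → EuclideanSpace ℝ (Fin N)) (u : Fin m → EuclideanSpace ℝ (Fin N)) :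
    (Fin N → ℝ) →ₗ[ℝ] ℝ × (ℂ × (Fin m → ℝ)) where
  toFun t := (inner ℝ (v 0) (WithLp.toLp 2 t),
    (⟨inner ℝ (v 1) (WithLp.toLp 2 t), inner ℝ (v 2) (WithLp.toLp 2 t)⟩,
      fun k => inner ℝ (u k) (WithLp.toLp 2 t)))
  map_add' s t := by
    refine Prod.ext ?_ (Prod.ext (Complex.ext ?_ ?_) ?_)
    all_goals first | ext | skip
    all_goals simp [inner_add_right]
  map_smul' c t := by
    refine Prod.ext ?_ (Prod.ext (Complex.ext ?_ ?_) ?_)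
    all_goals first | ext | skip
    all_goals simp [inner_smul_right]

/-- The matrix with rows `v` and `u`, with columns indexed like its rows. -/
noncomputable def rowMatrix (v : Fin 3 → EuclideanSpace ℝ (Fin N)) (u : Fin m → EuclideanSpace ℝ (Fin N))
    (e : Fin 3 ⊕ Fin m ≃ Fin N) : Matrix (Fin 3 ⊕ Fin m) (Fin 3 ⊕ Fin m) ℝ :=
  Matrix.of fun i j => Sum.elim v u i (e j)

lemma rowMatrix_mulVec (v : Fin 3 → EuclideanSpace ℝ (Fin N))
    (u : Fin m → EuclideanSpace ℝ (Fin N)) (e : Fin 3 ⊕ Fin m ≃ Fin N) (t : Fin N → ℝ)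
    (i : Fin 3 ⊕ Fin m) :
    (rowMatrix v u e).mulVec (t ∘ e) i = inner ℝ (Sum.elim v u i) (WithLp.toLp 2 t) := by
  rw [PiLp.inner_apply, ← e.sum_comp]
  simp [Matrix.mulVec, dotProduct, rowMatrix, mul_comm]

/-- The matrix times its transpose is the Gram matrix of all its rows, which is block diagonal with
blocks `Matrix.gram ℝ v` and the identity. -/
lemma sq_det_rowMatrix {v : Fin 3 → EuclideanSpace ℝ (Fin N)}
    {u : Fin m → EuclideanSpace ℝ (Fin N)} (hu : Orthonormal ℝ u)
    (huv : ∀ i k, inner ℝ (v i) (u k) = 0) (e : Fin 3 ⊕ Fin m ≃ Fin N) :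
    (rowMatrix v u e).det ^ 2 = (Matrix.gram ℝ v).det := by
  have h : rowMatrix v u e * (rowMatrix v u e).transpose =
      Matrix.fromBlocks (Matrix.gram ℝ v) 0 0 1 := by
    ext i j
    have : (rowMatrix v u e * (rowMatrix v u e).transpose) i j
        = inner ℝ (Sum.elim v u i) (Sum.elim v u j) := by
      rw [PiLp.inner_apply, ← e.sum_comp]
      simp [Matrix.mul_apply, rowMatrix, mul_comm]
    rw [this]
    rcases i with i | i <;> rcases j with j | j
    · simp [Matrix.gram_apply]
    · simp [huv]
    · simp [real_inner_comm, huv]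
    · simp [orthonormal_iff_ite.mp hu, Matrix.one_apply]
  have := congrArg Matrix.det h
  rw [Matrix.det_mul, Matrix.det_transpose, Matrix.det_fromBlocks_zero₂₁, Matrix.det_one,
    mul_one] at this
  rw [sq, this]

lemma sliceCoord_injective {v : Fin 3 → EuclideanSpace ℝ (Fin N)}
    {u : Fin m → EuclideanSpace ℝ (Fin N)} (hu : Orthonormal ℝ u)
    (huv : ∀ i k, inner ℝ (v i) (u k) = 0) (hG : (Matrix.gram ℝ v).det ≠ 0)
    (e : Fin 3 ⊕ Fin m ≃ Fin N) : Function.Injective (sliceCoord v u) := by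
  rw [← LinearMap.ker_eq_bot, LinearMap.ker_eq_bot']
  intro t ht
  have hdet : (rowMatrix v u e).det ≠ 0 := by
    intro h
    rw [← sq_det_rowMatrix hu huv e, h] at hG
    simp at hG
  simp only [sliceCoord, LinearMap.coe_mk, AddHom.coe_mk, Prod.mk_eq_zero, Complex.ext_iff,
    funext_iff] at ht
  obtain ⟨h0, ⟨h1, h2⟩, h3⟩ := ht
  have : t ∘ e = 0 := by
    refine Matrix.eq_zero_of_mulVec_eq_zero hdet (funext fun i => ?_)
    rw [rowMatrix_mulVec]
    rcases i with i | i
    · fin_cases i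
      · exact h0
      · exact h1
      · exact h2
    · exact h3 i
  ext i
  have h4 := congrFun this (e.symm i)
  simpa using h4

lemma map_sliceCoord_volume {v : Fin 3 → EuclideanSpace ℝ (Fin N)}
    {u : Fin m → EuclideanSpace ℝ (Fin N)} (hu : Orthonormal ℝ u)
    (huv : ∀ i k, inner ℝ (v i) (u k) = 0) (hG : (Matrix.gram ℝ v).det ≠ 0)
    (e : Fin 3 ⊕ Fin m ≃ Fin N) :
    (volume : Measure (Fin N → ℝ)).map (sliceCoord v u) =
      ENNReal.ofReal (√(Matrix.gram ℝ v).det)⁻¹ • volume := by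
  have hdet : (rowMatrix v u e).det ≠ 0 := by
    intro h
    rw [← sq_det_rowMatrix hu huv e, h] at hG
    simp at hG
  have habs : |(rowMatrix v u e).det⁻¹| = (√(Matrix.gram ℝ v).det)⁻¹ := by
    rw [← sq_det_rowMatrix hu huv e, Real.sqrt_sq_eq_abs, abs_inv]
  have h1 := (volume_measurePreserving_piCongrLeft (fun _ : Fin N => ℝ) e).symm
  have h2 := Real.map_matrix_volume_pi_eq_smul_volume_pi hdet
  have h3 := volume_measurePreserving_sumPiEquivProdPi (fun _ : Fin 3 ⊕ Fin m => ℝ)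
  have h4 : MeasurePreserving (fun p : Fin 3 → ℝ => (p 0, (⟨p 1, p 2⟩ : ℂ))) := by
    have := (MeasurePreserving.id (volume : Measure ℝ)).prod
      (Complex.volume_preserving_equiv_pi.symm)
    convert! this.comp (volume_preserving_piFinSuccAbove (fun _ : Fin 3 => ℝ) 0) using 1
    funext p
    refine Prod.ext rfl (Complex.ext ?_ ?_) <;> simp [Fin.tail]
  have h5 := h4.prod (MeasurePreserving.id (volume : Measure (Fin m → ℝ)))
  have h6 := measurePreserving_prodAssoc (volume : Measure ℝ) (volume : Measure ℂ)
    (volume : Measure (Fin m → ℝ))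
  have h7 := (h6.comp h5).comp h3
  -- The map factors as a reindexing by `e`, then the matrix, then a regrouping of coordinates. Only
  -- the matrix changes volume, so the pushforward is scaled by `|det|⁻¹`, which does not depend on
  -- `e`.
  have hcomp : ⇑(sliceCoord v u) = ((MeasurableEquiv.prodAssoc ∘
      Prod.map (fun p : Fin 3 → ℝ => (p 0, (⟨p 1, p 2⟩ : ℂ))) id) ∘
      MeasurableEquiv.sumPiEquivProdPi (fun _ : Fin 3 ⊕ Fin m => ℝ)) ∘
      (Matrix.toLin' (rowMatrix v u e)) ∘
      (MeasurableEquiv.piCongrLeft (fun _ : Fin N => ℝ) e).symm := by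
    funext t
    have hpi : (MeasurableEquiv.piCongrLeft (fun _ : Fin N => ℝ) e).symm t = t ∘ e := rfl
    have hrow := rowMatrix_mulVec v u e t
    simp only [Function.comp_apply, hpi, Matrix.toLin'_apply]
    change _ = ((rowMatrix v u e).mulVec (t ∘ e) (Sum.inl 0),
      ((⟨(rowMatrix v u e).mulVec (t ∘ e) (Sum.inl 1),
        (rowMatrix v u e).mulVec (t ∘ e) (Sum.inl 2)⟩ : ℂ),
        fun k => (rowMatrix v u e).mulVec (t ∘ e) (Sum.inr k)))
    simp only [hrow]
    rfl
  have hT : Measurable (Matrix.toLin' (rowMatrix v u e)) :=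
    (Matrix.toLin' (rowMatrix v u e)).continuous_of_finiteDimensional.measurable
  rw [hcomp, ← Measure.map_map h7.measurable (hT.comp h1.measurable),
    ← Measure.map_map hT h1.measurable, h1.map_eq, h2, habs, Measure.map_smul]
  congr 1
  exact h7.map_eq

/-- `sliceCoord` as a linear equivalence. -/
noncomputable def sliceEquiv {v : Fin 3 → EuclideanSpace ℝ (Fin N)}
    {u : Fin m → EuclideanSpace ℝ (Fin N)} (hu : Orthonormal ℝ u)
    (huv : ∀ i k, inner ℝ (v i) (u k) = 0) (hG : (Matrix.gram ℝ v).det ≠ 0)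
    (e : Fin 3 ⊕ Fin m ≃ Fin N) : (Fin N → ℝ) ≃ₗ[ℝ] ℝ × (ℂ × (Fin m → ℝ)) :=
  LinearMap.linearEquivOfInjective (sliceCoord v u) (sliceCoord_injective hu huv hG e) (by
    have := Fintype.card_congr e
    simp at this
    simp [Complex.finrank_real_complex]
    omega)

end Coordinates

/-! ### Volume of the cone as an integral of fibre volumes. -/

section Section

variable {N m : ℕ}

lemma sliceEquiv_apply {v : Fin 3 → EuclideanSpace ℝ (Fin N)}
    {u : Fin m → EuclideanSpace ℝ (Fin N)} (hu : Orthonormal ℝ u)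
    (huv : ∀ i k, inner ℝ (v i) (u k) = 0) (hG : (Matrix.gram ℝ v).det ≠ 0)
    (e : Fin 3 ⊕ Fin m ≃ Fin N) (t : Fin N → ℝ) :
    sliceEquiv hu huv hG e t = sliceCoord v u t := rfl

/-- The slice of the positive orthant with prescribed mass and means, in the coordinates given by
an orthonormal basis of its direction. -/
def orthantSlice (Φ : (Fin N → ℝ) ≃ₗ[ℝ] ℝ × (ℂ × (Fin m → ℝ))) (z : ℂ) : Set (Fin m → ℝ) :=
  {w | ∀ i, 0 ≤ Φ.symm (1, (z, w)) i}

lemma measurableSet_orthantPreimage (Φ : (Fin N → ℝ) ≃ₗ[ℝ] ℝ × (ℂ × (Fin m → ℝ))) :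
    MeasurableSet {p | ∀ i, 0 ≤ Φ.symm p i} := by
  have hc : Continuous Φ.symm := Φ.symm.toLinearMap.continuous_of_finiteDimensional
  have : {p | ∀ i, 0 ≤ Φ.symm p i} = Φ.symm ⁻¹' Ici 0 := by ext; simp [Pi.le_def]
  rw [this]
  exact (isClosed_Ici.preimage hc).measurableSet

lemma measurableSet_orthantSection (Φ : (Fin N → ℝ) ≃ₗ[ℝ] ℝ × (ℂ × (Fin m → ℝ))) :
    MeasurableSet {q : ℂ × (Fin m → ℝ) | ∀ i, 0 ≤ Φ.symm (1, q) i} :=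
  (measurable_prodMk_left : Measurable (Prod.mk (1 : ℝ) : ℂ × (Fin m → ℝ) → _))
    (measurableSet_orthantPreimage Φ)

lemma measurable_volume_orthantSlice (Φ : (Fin N → ℝ) ≃ₗ[ℝ] ℝ × (ℂ × (Fin m → ℝ))) :
    Measurable fun z => volume (orthantSlice Φ z) :=
  measurable_measure_prodMk_left (measurableSet_orthantSection Φ)

/-- The three factors are the inverse Jacobian, the integral over the height of the cone, and Fubini
for its base at height one. -/
lemma volume_meanCone {d : Fin N → ℂ} {u : Fin m → EuclideanSpace ℝ (Fin N)}
    (hu : Orthonormal ℝ u)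
    (huv : ∀ i k, inner ℝ (![onesVec N, reVec d, imVec d] i) (u k) = 0)
    (hG : (Matrix.gram ℝ ![onesVec N, reVec d, imVec d]).det ≠ 0)
    (e : Fin 3 ⊕ Fin m ≃ Fin N) {S : Set ℂ} (hS : MeasurableSet S) :
    volume (meanCone d S) =
      ENNReal.ofReal (√(Matrix.gram ℝ ![onesVec N, reVec d, imVec d]).det)⁻¹ *
        (ENNReal.ofReal (1 / N) * ∫⁻ z in S, volume (orthantSlice (sliceEquiv hu huv hG e) z)) := by
  set Φ := sliceEquiv hu huv hG e with hΦ
  have hcard := Fintype.card_congr e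
  simp only [Fintype.card_sum, Fintype.card_fin] at hcard
  let D : Set (ℝ × (ℂ × (Fin m → ℝ))) :=
    {p | (∀ i, 0 ≤ Φ.symm p i) ∧ (0 < p.1 ∧ p.1 < 1) ∧ p.2.1 / (p.1 : ℂ) ∈ S}
  let B : Set (ℂ × (Fin m → ℝ)) := {q | (∀ i, 0 ≤ Φ.symm (1, q) i) ∧ q.1 ∈ S}
  have hD : MeasurableSet D := by
    refine (measurableSet_orthantPreimage Φ).inter (MeasurableSet.inter ?_ ?_)
    · exact measurable_fst measurableSet_Ioo
    · exact (by fun_prop : Measurable fun p : ℝ × (ℂ × (Fin m → ℝ)) => p.2.1 / (p.1 : ℂ)) hS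
  have hB : MeasurableSet B := (measurableSet_orthantSection Φ).inter (measurable_fst hS)
  have hΦm : Measurable (sliceCoord ![onesVec N, reVec d, imVec d] u) :=
    (sliceCoord ![onesVec N, reVec d, imVec d] u).continuous_of_finiteDimensional.measurable
  have hpre : meanCone d S = sliceCoord ![onesVec N, reVec d, imVec d] u ⁻¹' D := by
    ext t
    have h0 : Φ.symm (sliceCoord ![onesVec N, reVec d, imVec d] u t) = t := by
      rw [← sliceEquiv_apply hu huv hG e, ← hΦ, LinearEquiv.symm_apply_apply]
    have h1 : (sliceCoord ![onesVec N, reVec d, imVec d] u t).1 = ∑ i, t i := by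
      simp [sliceCoord, onesVec, PiLp.inner_apply]
    have h2 : (sliceCoord ![onesVec N, reVec d, imVec d] u t).2.1 = ∑ i, d i * (t i : ℂ) := by
      apply Complex.ext
      · simp [sliceCoord, reVec, PiLp.inner_apply, mul_comm]
      · simp [sliceCoord, imVec, PiLp.inner_apply, mul_comm]
    simp only [mem_preimage, D, mem_ofPred_eq, h0, h1, h2, meanCone, and_assoc]
  -- Nonnegativity and the quotient mean are invariant under positive scaling, so `D` is a truncated
  -- cone over its section at height one.
  have hDB : ∀ s q, (s, q) ∈ D ↔ (0 < s ∧ s < 1) ∧ s⁻¹ • q ∈ B := by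
    intro s q
    simp only [D, B, mem_ofPred_eq]
    rw [and_left_comm]
    refine and_congr_right fun hs => ?_
    have h1 : ((1 : ℝ), s⁻¹ • q) = s⁻¹ • (s, q) := by simp [Prod.smul_mk, hs.1.ne']
    rw [h1, map_smul]
    refine and_congr (forall_congr' fun i => ?_) ?_
    · rw [Pi.smul_apply, smul_eq_mul, mul_nonneg_iff_of_pos_left (inv_pos.mpr hs.1)]
    · rw [Prod.smul_fst, Complex.real_smul, Complex.ofReal_inv, div_eq_inv_mul]
  have hdim : (Module.finrank ℝ (ℂ × (Fin m → ℝ)) : ℝ) + 1 = N := by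
    rw [Module.finrank_prod, Complex.finrank_real_complex, Module.finrank_fin_fun, ← hcard]
    push_cast; ring
  have : (volume : Measure (ℂ × (Fin m → ℝ))).IsAddHaarMeasure :=
    inferInstanceAs (volume.prod volume).IsAddHaarMeasure
  rw [hpre, ← Measure.map_apply hΦm hD, map_sliceCoord_volume hu huv hG e, Measure.smul_apply,
    smul_eq_mul, Measure.volume_eq_prod, Measure.prod_truncatedCone _ hD hDB, hdim,
    Measure.volume_eq_prod, Measure.prod_apply hB, ← lintegral_indicator hS]
  congr 2
  refine lintegral_congr fun z => ?_
  by_cases hz : z ∈ S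
  · rw [indicator_of_mem hz]
    congr 1
    ext w
    simp [B, hz, orthantSlice]
  · rw [indicator_of_notMem hz]
    refine measure_mono_null (t := ∅) ?_ measure_empty
    intro w hw
    exact hz hw.2

end Section

/-! ### Adapted matrices and the geometry of the image simplex. -/

namespace IsAdaptedMatrix

variable {N : ℕ} {W : Matrix (Fin N) (Fin N) ℝ} {x y : EuclideanSpace ℝ (Fin N)}

lemma transpose_mulVec_apply (W : Matrix (Fin N) (Fin N) ℝ) (r : Fin N → ℝ) (j : Fin N) :
    W.transpose.mulVec r j = inner ℝ (colVec W j) (WithLp.toLp 2 r) := by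
  simp [Matrix.mulVec, dotProduct, colVec, PiLp.inner_apply, mul_comm]

/-- The transpose of an adapted matrix is isometric on the orthogonal complement of `x` and `y`. -/
lemma norm_transpose_mulVec (hW : IsAdaptedMatrix W x y) {r : Fin N → ℝ}
    (hx : inner ℝ x (WithLp.toLp 2 r) = 0) (hy : inner ℝ y (WithLp.toLp 2 r) = 0) :
    ‖(WithLp.toLp 2 (W.transpose.mulVec r) : EuclideanSpace ℝ (Fin N))‖ =
      ‖(WithLp.toLp 2 r : EuclideanSpace ℝ (Fin N))‖ := by
  classical
  set p : EuclideanSpace ℝ (Fin N) := WithLp.toLp 2 r with hp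
  -- The vector lies in the span of the orthonormal columns, so the corresponding entries of its
  -- image are its coefficients there. The first two entries vanish, and Parseval gives equality of
  -- norms.
  have hmem : p ∈ Submodule.span ℝ
      (range fun j : {j : Fin N // 2 ≤ (j : ℕ)} => colVec W j) := by
    rw [hW.span_eq, Submodule.mem_orthogonal]
    intro q hq
    obtain ⟨a, b, rfl⟩ := Submodule.mem_span_pair.mp hq
    rw [inner_add_left, inner_smul_left, inner_smul_left, hx, hy]; simp
  obtain ⟨c, hc⟩ := (Submodule.mem_span_range_iff_exists_fun ℝ).mp hmem
  have hcj : ∀ j, inner ℝ (colVec W j.1) p = c j := by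
    intro j
    rw [← hc]
    exact hW.orthonormal.inner_right_fintype c j
  have hcoord : ∀ j, W.transpose.mulVec r j = if h : 2 ≤ (j : ℕ) then c ⟨j, h⟩ else 0 := by
    intro j
    rw [transpose_mulVec_apply, ← hp]
    split_ifs with h
    · exact hcj ⟨j, h⟩
    · rcases (by omega : (j : ℕ) = 0 ∨ (j : ℕ) = 1) with h | h
      · rw [hW.first j h, hx]
      · rw [hW.second j h, hy]
  have h1 : ‖p‖ ^ 2 = ∑ j, c j ^ 2 := by
    rw [← real_inner_self_eq_norm_sq]
    conv_lhs => rw [← hc]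
    rw [hW.orthonormal.inner_sum]
    simp [sq]
  have h2 : ‖(WithLp.toLp 2 (W.transpose.mulVec r) : EuclideanSpace ℝ (Fin N))‖ ^ 2
      = ∑ j, c j ^ 2 := by
    rw [EuclideanSpace.norm_sq_eq]
    simp only [hcoord]
    rw [← Fintype.sum_subtype_add_sum_subtype (fun j : Fin N => 2 ≤ (j : ℕ)),
      Finset.sum_eq_zero (s := (Finset.univ : Finset {j : Fin N // ¬ 2 ≤ (j : ℕ)}))
        (fun j _ => by simp [dif_neg j.2]), add_zero]
    exact Finset.sum_congr rfl fun j _ => by simp [dif_pos j.2]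
  exact (pow_left_inj₀ (norm_nonneg _) (norm_nonneg _) two_ne_zero).mp (h2.trans h1.symm)

/-- A vector in the kernel is orthogonal to the first two columns `x` and `y`; on such vectors the
map preserves norms, so the vector is zero. -/
lemma transpose_mulVec_injective (hW : IsAdaptedMatrix W x y) (hN : 2 ≤ N) :
    Function.Injective W.transpose.mulVec := by
  intro r s hrs
  have h0 : W.transpose.mulVec (r - s) = 0 := by rw [Matrix.mulVec_sub, hrs, sub_self]
  have hx : inner ℝ x (WithLp.toLp 2 (r - s)) = 0 := by
    rw [← hW.first ⟨0, by omega⟩ rfl, ← transpose_mulVec_apply, h0]; rfl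
  have hy : inner ℝ y (WithLp.toLp 2 (r - s)) = 0 := by
    rw [← hW.second ⟨1, by omega⟩ rfl, ← transpose_mulVec_apply, h0]; rfl
  have := hW.norm_transpose_mulVec hx hy
  rw [h0] at this
  have h1 : (WithLp.toLp 2 (r - s) : EuclideanSpace ℝ (Fin N)) = 0 := by
    rw [← norm_eq_zero, ← this]; simp
  simpa [sub_eq_zero] using h1

end IsAdaptedMatrix

/-- The simplex is the convex hull of `N` affinely independent points. -/
lemma finrank_vectorSpan_stdSimplex {N : ℕ} (hN : 0 < N) :
    Module.finrank ℝ (vectorSpan ℝ (stdSimplex ℝ (Fin N))) = N - 1 := by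
  rw [← convexHull_basis_eq_stdSimplex, ← direction_affineSpan, affineSpan_convexHull,
    direction_affineSpan]
  refine AffineIndependent.finrank_vectorSpan ?_ (by simp; omega)
  have := (Pi.basisFun ℝ (Fin N)).linearIndependent
  convert! this.affineIndependent using 3
  rw [Pi.basisFun_apply]
  simp [Pi.single_apply, eq_comm]

section

variable {N m : ℕ}

lemma IsAdaptedMatrix.finrank_vectorSpan_simplexImage {W : Matrix (Fin N) (Fin N) ℝ}
    {x y : EuclideanSpace ℝ (Fin N)} (hW : IsAdaptedMatrix W x y) (hN : 2 ≤ N) :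
    Module.finrank ℝ (vectorSpan ℝ (simplexImage W)) = N - 1 := by
  let L : (Fin N → ℝ) →ₗ[ℝ] EuclideanSpace ℝ (Fin N) :=
    (WithLp.linearEquiv 2 ℝ (Fin N → ℝ)).symm.toLinearMap ∘ₗ W.transpose.mulVecLin
  have hL : Function.Injective L :=
    (WithLp.linearEquiv 2 ℝ (Fin N → ℝ)).symm.injective.comp (hW.transpose_mulVec_injective hN)
  have h : simplexImage W = L.toAffineMap '' stdSimplex ℝ (Fin N) := rfl
  rw [h, ← AffineMap.map_vectorSpan, LinearMap.toAffineMap_linear,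
    ← (Submodule.equivMapOfInjective L hL _).finrank_eq, finrank_vectorSpan_stdSimplex (by omega)]

lemma mem_bSplineSlice_two {k n : ℕ} (h : 2 + k = n) (σ : Set (EuclideanSpace ℝ (Fin n)))
    (a b : ℝ) (v : EuclideanSpace ℝ (Fin n)) :
    v ∈ bSplineSlice 2 k h σ ![a, b] ↔
      v ∈ σ ∧ v ⟨0, by omega⟩ = a ∧ v ⟨1, by omega⟩ = b := by
  simp only [bSplineSlice, mem_inter_iff, mem_ofPred_eq, Fin.forall_fin_two]
  rfl

lemma exists_isAdaptedMatrix {x y : EuclideanSpace ℝ (Fin N)} (hN : 2 ≤ N)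
    (h : LinearIndependent ℝ ![x, y]) : ∃ W, IsAdaptedMatrix W x y := by
  classical
  have hfin : Module.finrank ℝ (Submodule.span ℝ {x, y})ᗮ = N - 2 := by
    have h1 := (Submodule.span ℝ {x, y}).finrank_add_finrank_orthogonal
    have h2 : Module.finrank ℝ (Submodule.span ℝ {x, y}) = 2 := by
      have hr : range ![x, y] = {x, y} := by
        rw [Matrix.range_cons, Matrix.range_cons, Matrix.range_empty, union_empty,
          singleton_union]
      rw [← hr, finrank_span_eq_card h, Fintype.card_fin]
    rw [finrank_euclideanSpace_fin] at h1
    omega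
  have hcard : Fintype.card {j : Fin N // 2 ≤ (j : ℕ)} = N - 2 := by
    have e : {j : Fin N // 2 ≤ (j : ℕ)} ≃ Fin (N - 2) :=
      { toFun := fun j => ⟨j.1 - 2, by have := j.1.2; have := j.2; omega⟩
        invFun := fun k => ⟨⟨k + 2, by omega⟩, by simp⟩
        left_inv := fun j => by
          have := j.2
          apply Subtype.ext; apply Fin.ext
          change (j.1 : ℕ) - 2 + 2 = j.1
          omega
        right_inv := fun k => by apply Fin.ext; simp }
    rw [Fintype.card_congr e, Fintype.card_fin]
  let b := (stdOrthonormalBasis ℝ (Submodule.span ℝ {x, y})ᗮ).reindex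
    (Fintype.equivOfCardEq (by rw [Fintype.card_fin, hfin, hcard]) :
      _ ≃ {j : Fin N // 2 ≤ (j : ℕ)})
  let c : Fin N → EuclideanSpace ℝ (Fin N) := fun j =>
    if h : 2 ≤ (j : ℕ) then (b ⟨j, h⟩ : EuclideanSpace ℝ (Fin N)) else
      if (j : ℕ) = 0 then x else y
  have hc : ∀ j, colVec (Matrix.of fun i j => c j i) j = c j := fun j => rfl
  have hcb : (fun j : {j : Fin N // 2 ≤ (j : ℕ)} => c j) = fun j => (b j : EuclideanSpace ℝ _) := by
    funext j
    simp [c, j.2]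
  refine ⟨Matrix.of fun i j => c j i, ⟨fun j hj => ?_, fun j hj => ?_, ?_, ?_⟩⟩
  · simp [hc, c, hj]
  · simp [hc, c, hj]
  · simp only [hc, hcb]
    exact b.orthonormal.comp_linearIsometry (Submodule.subtypeₗᵢ _)
  · simp only [hc, hcb]
    have h1 := b.toBasis.span_eq
    have h2 := congrArg (Submodule.map (Submodule.subtype _)) h1
    rw [Submodule.map_span, Submodule.map_subtype_top, ← range_comp] at h2
    refine Eq.trans ?_ h2
    congr 1

/-- A relation `g 0 + g 1 * re + g 2 * im = 0` with `g 1, g 2` not both zero is the equation of a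
line, with direction `(-g 2, g 1)`, through every eigenvalue; otherwise `g 0` vanishes too. -/
lemma linearIndependent_ones_re_im [NeZero N] {d : Fin N → ℂ} (h : ¬ Collinear ℝ (range d)) :
    LinearIndependent ℝ ![onesVec N, reVec d, imVec d] := by
  rw [Fintype.linearIndependent_iff]
  intro g hg
  have hg' : ∀ i, g 0 + g 1 * (d i).re + g 2 * (d i).im = 0 := by
    intro i
    have := congrArg (fun v : EuclideanSpace ℝ (Fin N) => v i) hg
    simpa [Fin.sum_univ_three, onesVec, reVec, imVec] using this
  by_cases h12 : g 1 = 0 ∧ g 2 = 0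
  · have h0 := hg' 0
    rw [h12.1, h12.2] at h0
    intro i
    fin_cases i
    · simpa using h0
    · exact h12.1
    · exact h12.2
  · exfalso
    have hpos : g 1 ^ 2 + g 2 ^ 2 ≠ 0 := by
      intro h0
      exact h12 ⟨by nlinarith [sq_nonneg (g 1), sq_nonneg (g 2)],
        by nlinarith [sq_nonneg (g 1), sq_nonneg (g 2)]⟩
    apply h
    rw [collinear_iff_exists_forall_eq_smul_vadd]
    refine ⟨d 0, ⟨-g 2, g 1⟩, ?_⟩
    rintro _ ⟨i, rfl⟩
    have h0 := hg' 0
    have hi := hg' i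
    refine ⟨(g 1 * ((d i).im - (d 0).im) - g 2 * ((d i).re - (d 0).re)) /
      (g 1 ^ 2 + g 2 ^ 2), Complex.ext ?_ ?_⟩
    · simp only [vadd_eq_add, Complex.add_re, Complex.real_smul, Complex.re_ofReal_mul]
      field_simp
      linear_combination g 1 * hi - g 1 * h0
    · simp only [vadd_eq_add, Complex.add_im, Complex.real_smul, Complex.im_ofReal_mul]
      field_simp
      linear_combination g 2 * hi - g 2 * h0

lemma exists_orthonormal_orthogonal {k : ℕ} {v : Fin k → EuclideanSpace ℝ (Fin N)}
    (hv : LinearIndependent ℝ v) (hN : k + m = N) :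
    ∃ u : Fin m → EuclideanSpace ℝ (Fin N), Orthonormal ℝ u ∧ ∀ i j, inner ℝ (v i) (u j) = 0 := by
  have hfin : Module.finrank ℝ (Submodule.span ℝ (range v))ᗮ = m := by
    have h1 := (Submodule.span ℝ (range v)).finrank_add_finrank_orthogonal
    have h2 := finrank_span_eq_card hv
    rw [finrank_euclideanSpace_fin] at h1
    rw [Fintype.card_fin] at h2
    omega
  let b := (stdOrthonormalBasis ℝ (Submodule.span ℝ (range v))ᗮ).reindex (finCongr hfin)
  refine ⟨fun j => b j, b.orthonormal.comp_linearIsometry (Submodule.subtypeₗᵢ _), fun i j => ?_⟩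
  exact Submodule.inner_right_of_mem_orthogonal (Submodule.subset_span (mem_range_self i)) (b j).2

/-- The slices of the positive orthant and of the image of the simplex have the same volume. -/
lemma IsAdaptedMatrix.euclideanHausdorffMeasure_bSplineSlice {d : Fin N → ℂ}
    {u : Fin m → EuclideanSpace ℝ (Fin N)} (hu : Orthonormal ℝ u)
    (huv : ∀ i k, inner ℝ (![onesVec N, reVec d, imVec d] i) (u k) = 0)
    (hG : (Matrix.gram ℝ ![onesVec N, reVec d, imVec d]).det ≠ 0)
    (e : Fin 3 ⊕ Fin m ≃ Fin N) {W : Matrix (Fin N) (Fin N) ℝ}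
    (hW : IsAdaptedMatrix W (reVec d) (imVec d)) {k : ℕ} (hk : 2 + k = N) (z : ℂ) :
    μHE[m] (bSplineSlice 2 k hk (simplexImage W) ![z.re, z.im]) =
      volume (orthantSlice (sliceEquiv hu huv hG e) z) := by
  set Φ := sliceEquiv hu huv hG e with hΦ
  have hΦa : ∀ t, Φ t = sliceCoord ![onesVec N, reVec d, imVec d] u t := fun t => rfl
  have hdir : ∀ w : Fin m → ℝ, Φ.symm (0, (0, w)) = (∑ k, w k • u k).ofLp := by
    intro w
    rw [LinearEquiv.symm_apply_eq, hΦa]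
    have h1 : ∀ i, inner ℝ (![onesVec N, reVec d, imVec d] i) (∑ k, w k • u k) = 0 := by
      intro i
      rw [inner_sum]
      exact Finset.sum_eq_zero fun k _ => by rw [inner_smul_right, huv, mul_zero]
    refine Prod.ext (h1 0).symm (Prod.ext (Complex.ext (h1 1).symm (h1 2).symm) ?_)
    funext k
    exact (hu.inner_right_fintype w k).symm
  -- An isometric parametrisation of the slice: differences of points of the fibre are combinations
  -- of the `u k`, hence orthogonal to `x` and `y`. Hausdorff measure of the slice then becomes
  -- Lebesgue measure of the parameters.
  let g : EuclideanSpace ℝ (Fin m) → EuclideanSpace ℝ (Fin N) := fun w =>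
    WithLp.toLp 2 (W.transpose.mulVec (Φ.symm (1, (z, w.ofLp))))
  have hg : Isometry g := by
    refine Isometry.of_dist_eq fun w w' => ?_
    have h1 : g w - g w' = WithLp.toLp 2 (W.transpose.mulVec
        (∑ k, (w - w') k • u k).ofLp) := by
      rw [← hdir]
      have : ((0 : ℝ), ((0 : ℂ), (w - w').ofLp)) = (1, (z, w.ofLp)) - (1, (z, w'.ofLp)) := by
        simp
      rw [this, map_sub, Matrix.mulVec_sub]
      rfl
    have h2 : ∀ i, inner ℝ (![onesVec N, reVec d, imVec d] i) (∑ k, (w - w') k • u k) = 0 := by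
      intro i
      rw [inner_sum]
      exact Finset.sum_eq_zero fun k _ => by rw [inner_smul_right, huv, mul_zero]
    rw [dist_eq_norm, dist_eq_norm, h1, hW.norm_transpose_mulVec (r := (∑ k, (w - w') k • u k).ofLp) (h2 1) (h2 2)]
    refine (pow_left_inj₀ (norm_nonneg _) (norm_nonneg _) two_ne_zero).mp ?_
    rw [WithLp.toLp_ofLp, ← real_inner_self_eq_norm_sq, hu.inner_sum, EuclideanSpace.norm_sq_eq]
    simp [sq]
  have himage : bSplineSlice 2 k hk (simplexImage W) ![z.re, z.im] =
      g '' (WithLp.ofLp ⁻¹' orthantSlice Φ z) := by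
    ext p
    rw [mem_bSplineSlice_two]
    constructor
    · rintro ⟨⟨r, hr, rfl⟩, h0, h1⟩
      have h2 : Φ r = (1, (z, (Φ r).2.2)) := by
        refine Prod.ext ?_ (Prod.ext (Complex.ext ?_ ?_) rfl)
        · rw [hΦa, ← hr.2]
          simp [sliceCoord, onesVec, PiLp.inner_apply]
        · rw [← h0]
          change _ = W.transpose.mulVec r _
          rw [IsAdaptedMatrix.transpose_mulVec_apply, hW.first _ rfl]
          rfl
        · rw [← h1]
          change _ = W.transpose.mulVec r _
          rw [IsAdaptedMatrix.transpose_mulVec_apply, hW.second _ rfl]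
          rfl
      have h3 : Φ.symm (1, (z, (Φ r).2.2)) = r := by rw [← h2, LinearEquiv.symm_apply_apply]
      refine ⟨WithLp.toLp 2 (Φ r).2.2, ?_, ?_⟩
      · simp only [mem_preimage, orthantSlice, mem_ofPred_eq, h3]
        exact hr.1
      · simp only [g, h3]
    · rintro ⟨w, hw, rfl⟩
      set r := Φ.symm (1, (z, w.ofLp)) with hr
      have h2 : sliceCoord ![onesVec N, reVec d, imVec d] u r = (1, (z, w.ofLp)) := by
        rw [← hΦa, hr, LinearEquiv.apply_symm_apply]
      refine ⟨⟨r, ⟨hw, ?_⟩, rfl⟩, ?_, ?_⟩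
      · have : (sliceCoord ![onesVec N, reVec d, imVec d] u r).1 = ∑ i, r i := by
          simp [sliceCoord, onesVec, PiLp.inner_apply]
        rw [← this, h2]
      · have := congrArg (fun p => p.2.1.re) h2
        change W.transpose.mulVec r _ = _
        rw [IsAdaptedMatrix.transpose_mulVec_apply, hW.first _ rfl]
        exact this
      · have := congrArg (fun p => p.2.1.im) h2
        change W.transpose.mulVec r _ = _
        rw [IsAdaptedMatrix.transpose_mulVec_apply, hW.second _ rfl]
        exact this
  have hmeas : MeasurableSet (orthantSlice Φ z) :=
    (measurable_prodMk_left : Measurable (Prod.mk z : (Fin m → ℝ) → _))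
      (measurableSet_orthantSection Φ)
  rw [himage, hg.euclideanHausdorffMeasure_image, EuclideanSpace.euclideanHausdorffMeasure_eq_volume,
    (PiLp.volume_preserving_ofLp (Fin m)).measure_preimage hmeas.nullMeasurableSet]

end

end

/-! ### Assembly of the density formula. -/

/-- `lam` lists the eigenvalues of the normal matrix `A` with multiplicity. -/
theorem proposition4p3 {N : ℕ} (hN : 3 ≤ N) (A : Matrix (Fin N) (Fin N) ℂ) (hA : IsStarNormal A)
    (lam : Fin N → ℂ) (hlam : A.charpoly.roots = Finset.univ.val.map lam)
    (hindep : LinearIndependent ℝ ![reVec lam, imVec lam])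
    (hcol : ¬ Collinear ℝ (Set.range lam)) :
    (∃ W : Matrix (Fin N) (Fin N) ℝ, IsAdaptedMatrix W (reVec lam) (imVec lam)) ∧
    ∀ W : Matrix (Fin N) (Fin N) ℝ, IsAdaptedMatrix W (reVec lam) (imVec lam) →
      (∀ a b : ℝ,
        bSpline 2 (N - 2) (by omega) (simplexImage W) ![a, b] =
          μHE[N - 3] (bSplineSlice 2 (N - 2) (by omega) (simplexImage W) ![a, b])) ∧
      Measurable (fun z : ℂ => bSpline 2 (N - 2) (by omega) (simplexImage W) ![z.re, z.im]) ∧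
      0 < shadowConst lam ∧
      numericalShadow A = (MeasureTheory.volume : MeasureTheory.Measure ℂ).withDensity
        (fun z : ℂ => ENNReal.ofReal (shadowConst lam) *
          bSpline 2 (N - 2) (by omega) (simplexImage W) ![z.re, z.im]) := by
  have : NeZero N := ⟨by omega⟩
  refine ⟨exists_isAdaptedMatrix (by omega) hindep, fun W hW => ?_⟩
  have hlin := linearIndependent_ones_re_im hcol
  have hGpos : 0 < (Matrix.gram ℝ ![onesVec N, reVec lam, imVec lam]).det :=
    (Matrix.posDef_gram_of_linearIndependent hlin).det_pos
  obtain ⟨u, hu, huv⟩ := exists_orthonormal_orthogonal (m := N - 3) hlin (by simp; omega)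
  obtain ⟨e⟩ : Nonempty (Fin 3 ⊕ Fin (N - 3) ≃ Fin N) :=
    ⟨Fintype.equivOfCardEq (by simp; omega)⟩
  have hspline : ∀ a b : ℝ, bSpline 2 (N - 2) (by omega) (simplexImage W) ![a, b] =
      μHE[N - 3] (bSplineSlice 2 (N - 2) (by omega) (simplexImage W) ![a, b]) := by
    intro a b
    -- The image simplex has dimension `N - 1`, so its slices are measured in dimension `N - 1 - 2 =
    -- N - 3`.
    rw [bSpline, hW.finrank_vectorSpan_simplexImage (by omega), Nat.sub_sub]
  have hvol : ∀ z : ℂ, bSpline 2 (N - 2) (by omega) (simplexImage W) ![z.re, z.im] =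
      MeasureTheory.volume (orthantSlice (sliceEquiv hu huv hGpos.ne' e) z) := by
    intro z
    rw [hspline, hW.euclideanHausdorffMeasure_bSplineSlice hu huv hGpos.ne' e]
  have hmeas := measurable_volume_orthantSlice (sliceEquiv hu huv hGpos.ne' e)
  have hc : 0 < shadowConst lam :=
    div_pos (by exact_mod_cast Nat.factorial_pos _) (Real.sqrt_pos.mpr hGpos)
  refine ⟨hspline, by simpa only [hvol] using hmeas, hc, ?_⟩
  obtain ⟨b, hb⟩ := exists_orthonormalBasis_eigenvectors_of_roots hA hlam
  ext S hS
  simp only [hvol]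
  rw [numericalShadow_apply (by omega) b hb hS, MeasureTheory.withDensity_apply _ hS,
    MeasureTheory.lintegral_const_mul _ hmeas, volume_meanCone hu huv hGpos.ne' e hS, ← mul_assoc, ← mul_assoc]
  congr 1
  -- What remains is `N! · (√det G)⁻¹ · (1/N) = (N-1)! / √det G`.
  rw [← ENNReal.ofReal_natCast, ← ENNReal.ofReal_mul (by positivity),
    ← ENNReal.ofReal_mul (by positivity), shadowConst]
  congr 1
  rw [← Nat.mul_factorial_pred (by omega : N ≠ 0)]
  have : (N : ℝ) ≠ 0 := by exact_mod_cast (by omega : N ≠ 0)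
  push_cast
  field_simp
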